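/- Let $(K,\partial)$ be a differential field of characteristic zero, let $K\{x_1,\dots,x_n\}=K[x_i^{(r)} : 1\le i\le n,\ r\ge 0]$ be the ring of differential polynomials, with the derivation that extends $\partial$ and satisfies $\partial x_i^{(r)}=x_i^{(r+1)}$, let $u_1,\dots,u_n\in K\{x_1,\dots,x_n\}$, and let $[u_1,\dots,u_n]$ be the ideal generated by the $u_i$ and all their derivatives. Put $\Sigma=\operatorname{Spec} K\{x_1,\dots,x_n\}/[u_1,\dots,u_n]$. Let $\Sigma_1$ be an irreducible component of $\Sigma$, with any structure of closed subscheme of $\Sigma$ on it, and let $\eta_1$ be its generic point. Assume that $\Sigma_1$ is generically reduced, i.e. that the local ring $\mathcal{O}_{\Sigma,\eta_1}$ is reduced, and that $\Sigma_1$ has finite Krull dimension. Then there exist nonempty open subsets $U'\subseteq U\subseteq\Sigma_1$ such that $U$ is of finite type over $K$ and $U'$ is smooth over $K$. -/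

import Mathlib

open CategoryTheory AlgebraicGeometry
open scoped Differential


universe w
noncomputable section

namespace DiffPoly

/-- The additive map on polynomials that differentiates every coefficient and treats the
variables as constants. -/
def coeffDerivFun {K σ : Type*} [CommRing K] [Differential K] (f : MvPolynomial σ K) :
    MvPolynomial σ K :=
  ∑ m ∈ f.support, MvPolynomial.monomial m (MvPolynomial.coeff m f)′

theorem coeff_coeffDerivFun {K σ : Type*} [CommRing K] [Differential K]
    (f : MvPolynomial σ K) (m : σ →₀ ℕ) :
    MvPolynomial.coeff m (coeffDerivFun f) = (MvPolynomial.coeff m f)′ := by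
  classical
  rw [coeffDerivFun, MvPolynomial.coeff_sum]
  simp only [MvPolynomial.coeff_monomial]
  rw [Finset.sum_ite_eq']
  split_ifs with h
  · rfl
  · rw [MvPolynomial.notMem_support_iff.mp h, map_zero]

/-- The derivation on `MvPolynomial σ K` that extends the derivation of `K` and kills every
variable. -/
def coeffDeriv (K σ : Type*) [CommRing K] [Differential K] :
    Derivation ℤ (MvPolynomial σ K) (MvPolynomial σ K) :=
  Derivation.mk'
    (AddMonoidHom.toIntLinearMap
      { toFun := coeffDerivFun
        map_zero' := by ext m; simp [coeff_coeffDerivFun]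
        map_add' := fun f g => by ext m; simp [coeff_coeffDerivFun] })
    (fun f g => by
      classical
      ext m
      change MvPolynomial.coeff m (coeffDerivFun (f * g)) =
        MvPolynomial.coeff m (f • coeffDerivFun g + g • coeffDerivFun f)
      rw [smul_eq_mul, smul_eq_mul, mul_comm g, coeff_coeffDerivFun, MvPolynomial.coeff_add,
        MvPolynomial.coeff_mul, MvPolynomial.coeff_mul, MvPolynomial.coeff_mul, map_sum,
        ← Finset.sum_add_distrib]
      refine Finset.sum_congr rfl fun x _ => ?_
      rw [coeff_coeffDerivFun, coeff_coeffDerivFun, Derivation.leibniz, smul_eq_mul, smul_eq_mul,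
        mul_comm (MvPolynomial.coeff x.2 g)])

end DiffPoly

/-- The ring `K{x₁, …, xₙ}` of differential polynomials: polynomials over `K` in the variables
`x_i^{(r)}`, where `(i, r)` stands for `x_i^{(r)}`. -/
abbrev DiffPoly (K : Type*) [CommRing K] (n : ℕ) : Type _ := MvPolynomial (Fin n × ℕ) K

namespace DiffPoly

/-- The derivation of `K{x₁, …, xₙ}`: it extends the one of `K` and sends `x_i^{(r)}` to
`x_i^{(r+1)}`. -/
instance instDifferential (K : Type*) [CommRing K] [Differential K] (n : ℕ) :
    Differential (DiffPoly K n) where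
  deriv := coeffDeriv K (Fin n × ℕ) +
    (MvPolynomial.mkDerivation K
      (fun v : Fin n × ℕ => (MvPolynomial.X (v.1, v.2 + 1) : DiffPoly K n))).restrictScalars ℤ

theorem deriv_C {K : Type*} [CommRing K] [Differential K] {n : ℕ} (a : K) :
    (MvPolynomial.C a : DiffPoly K n)′ = MvPolynomial.C a′ := by
  classical
  have h : coeffDerivFun (MvPolynomial.C a : DiffPoly K n) = MvPolynomial.C a′ := by
    ext m
    rw [coeff_coeffDerivFun, MvPolynomial.coeff_C, MvPolynomial.coeff_C]
    split_ifs <;> simp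
  change coeffDerivFun (MvPolynomial.C a : DiffPoly K n) + MvPolynomial.mkDerivation K _ _ = _
  rw [h, MvPolynomial.derivation_C, add_zero]

theorem deriv_X {K : Type*} [CommRing K] [Differential K] {n : ℕ} (i : Fin n) (r : ℕ) :
    (MvPolynomial.X (i, r) : DiffPoly K n)′ = MvPolynomial.X (i, r + 1) := by
  classical
  have h : coeffDerivFun (MvPolynomial.X (i, r) : DiffPoly K n) = 0 := by
    ext m
    rw [coeff_coeffDerivFun, MvPolynomial.coeff_X]
    split_ifs <;> simp
  change coeffDerivFun (MvPolynomial.X (i, r) : DiffPoly K n) +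
    MvPolynomial.mkDerivation K _ _ = _
  rw [h, MvPolynomial.mkDerivation_X, zero_add]

instance instDifferentialAlgebra (K : Type*) [CommRing K] [Differential K] (n : ℕ) :
    DifferentialAlgebra K (DiffPoly K n) where
  deriv_algebraMap := deriv_C

/-- The differential ideal `[u₁, …, uₑ]`, generated by the `u_i` and all their derivatives. -/
def diffIdeal {K : Type*} [CommRing K] [Differential K] {n e : ℕ} (u : Fin e → DiffPoly K n) :
    Ideal (DiffPoly K n) :=
  Ideal.span {f | ∃ (i : Fin e) (j : ℕ), f = (fun g : DiffPoly K n => g′)^[j] (u i)}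

end DiffPoly

/-- The scheme `Σ = Spec K{x₁, …, xₙ}/[u₁, …, uₑ]`. -/
def diffScheme {K : Type w} [CommRing K] [Differential K] {n e : ℕ} (u : Fin e → DiffPoly K n) :
    Scheme.{w} :=
  Spec (CommRingCat.of (DiffPoly K n ⧸ DiffPoly.diffIdeal u))

/-- The structure morphism `Σ ⟶ Spec K`. -/
def diffScheme.toSpec {K : Type w} [CommRing K] [Differential K] {n e : ℕ}
    (u : Fin e → DiffPoly K n) : diffScheme u ⟶ Spec (CommRingCat.of K) :=
  Spec.map (CommRingCat.ofHom (algebraMap K (DiffPoly K n ⧸ DiffPoly.diffIdeal u)))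

end

/-! Let `R` be the coordinate ring of Σ, `p` the minimal prime of the component and `φ : R → κ(p)`.
Reducedness makes `R_p` a field, so every element of `ker φ` is killed by some `g ∉ p`; in this form
(`hker`) the hypothesis can be differentiated.

Order the variables by `rank` and call one a leader if its image is algebraic over the preceding
images. In characteristic zero a leader satisfies a relation with nonzero separant `S`. Repeated
differentiation makes this relation linear, with coefficient `S`, in each later derivative, up to a
power of `g` (`IsLeader.exists_relation`). Where `S` and `g` are invertible, these derivatives are
therefore polynomials in earlier variables and `S⁻¹`.

If every `x_i` has a leader among its derivatives, inverting finitely many elements makes `R`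
finitely generated (`finiteType_away_of_isLeader`). Otherwise infinitely many non-leaders are
algebraically independent, and a localization of `φ(R)` is a polynomial ring in infinitely many
variables over a field, which contradicts finite dimension (`ringKrullDim_eq_top_of_not_isLeader`).
Generic smoothness in characteristic zero finishes the proof. -/

namespace DiffPoly

/-- The position of `x_i^{(r)}` in an orderly enumeration of the variables. -/
def rank {n : ℕ} (v : Fin n × ℕ) : ℕ := v.2 * n + v.1

theorem rank_succ {n : ℕ} (i : Fin n) (r : ℕ) : rank (i, r + 1) = rank (i, r) + n := by
  simp only [rank]; ring

theorem rank_add {n : ℕ} (i : Fin n) (r k : ℕ) : rank (i, r + k) = rank (i, r) + k * n := by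
  simp only [rank]; ring

theorem rank_injective {n : ℕ} : Function.Injective (rank (n := n)) := by
  rintro ⟨i, r⟩ ⟨j, s⟩ h
  simp only [rank] at h
  have hi : (i : ℕ) = j := by
    have := congrArg (· % n) h
    simpa [Nat.mul_add_mod_of_lt, Nat.add_mod, Nat.mod_eq_of_lt i.2, Nat.mod_eq_of_lt j.2] using this
  have hn : 0 < n := i.pos
  rw [hi] at h
  have hr : r = s := Nat.eq_of_mul_eq_mul_right hn (Nat.add_right_cancel h)
  exact Prod.ext (Fin.ext hi) hr

/-! ### Orderly ranking and iterated derivatives of a relation -/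

section Derivation

variable {K R : Type*} [CommRing K] [CommRing R] [Algebra K R] {n : ℕ}

/-- The subalgebra generated by the first `N` variables. -/
def lower (K : Type*) {R : Type*} [CommRing K] [CommRing R] [Algebra K R] {n : ℕ}
    (x : Fin n × ℕ → R) (N : ℕ) : Subalgebra K R :=
  Algebra.adjoin K (x '' {w | rank w < N})

theorem mem_lower (x : Fin n × ℕ → R) {N : ℕ} {v : Fin n × ℕ} (h : rank v < N) :
    x v ∈ lower K x N :=
  Algebra.subset_adjoin ⟨v, h, rfl⟩

theorem lower_mono (x : Fin n × ℕ → R) {M N : ℕ} (h : M ≤ N) : lower K x M ≤ lower K x N :=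
  Algebra.adjoin_mono (Set.image_mono fun _ hw => lt_of_lt_of_le hw h)

variable {D : Derivation ℤ R R} (hD : ∀ a : K, ∃ b : K, D (algebraMap K R a) = algebraMap K R b)
  {x : Fin n × ℕ → R} (hx : ∀ i r, D (x (i, r)) = x (i, r + 1))

include hD hx in
theorem deriv_mem_lower {N : ℕ} {a : R} (ha : a ∈ lower K x N) :
    D a ∈ lower K x (N + n) := by
  have hle : lower K x N ≤ lower K x (N + n) := lower_mono x (Nat.le_add_right _ _)
  unfold lower at ha
  induction ha using Algebra.adjoin_induction with
  | mem a h =>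
    obtain ⟨⟨i, r⟩, hw, rfl⟩ := h
    rw [hx]
    exact mem_lower x (by rw [rank_succ]; exact Nat.add_lt_add_right hw n)
  | algebraMap a =>
    obtain ⟨b, hb⟩ := hD a
    rw [hb]
    exact Subalgebra.algebraMap_mem _ _
  | add a b _ _ ha hb => rw [map_add]; exact add_mem ha hb
  | mul a b ha' hb' ha hb =>
    rw [Derivation.leibniz, smul_eq_mul, smul_eq_mul]
    exact add_mem (mul_mem (hle ha') hb) (mul_mem (hle hb') ha)

include hD hx in
theorem deriv_aeval_eq (i : Fin n) (r : ℕ) (f : Polynomial (lower K x (rank (i, r)))) :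
    ∃ t ∈ lower K x (rank (i, r + 1)), D (Polynomial.aeval (x (i, r)) f) =
      Polynomial.aeval (x (i, r)) (Polynomial.derivative f) * x (i, r + 1) + t := by
  rw [rank_succ]
  induction f using Polynomial.induction_on' with
  | add f g hf hg =>
    obtain ⟨s, hs, hf⟩ := hf
    obtain ⟨t, ht, hg⟩ := hg
    refine ⟨s + t, add_mem hs ht, ?_⟩
    simp only [map_add, hf, hg]
    ring
  | monomial k a =>
    refine ⟨D (a : R) * x (i, r) ^ k, mul_mem (deriv_mem_lower hD hx a.2)
      (pow_mem (mem_lower x (Nat.lt_add_of_pos_right i.pos)) _), ?_⟩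
    rw [Polynomial.derivative_monomial, Polynomial.aeval_monomial, Polynomial.aeval_monomial,
      Derivation.leibniz, Derivation.leibniz_pow, hx]
    simp only [Subalgebra.algebraMap_def, Algebra.algebraMap_self_apply, smul_eq_mul, nsmul_eq_mul,
      MulMemClass.coe_mul, SubringClass.coe_natCast]
    ring

theorem aeval_mem_lower_succ (v : Fin n × ℕ) (f : Polynomial (lower K x (rank v))) :
    Polynomial.aeval (x v) f ∈ lower K x (rank v + 1) := by
  rw [Polynomial.aeval_eq_sum_range]
  refine sum_mem fun k _ => ?_
  rw [Algebra.smul_def]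
  exact mul_mem (lower_mono x (Nat.le_succ _) (f.coeff k).2)
    (pow_mem (mem_lower x (Nat.lt_succ_self _)) _)

include hD hx in
-- The first derivation produces the separant as coefficient of the new top variable; further ones
-- shift that variable and push everything else into lower rank.
theorem iterate_deriv_aeval_eq (i : Fin n) (r : ℕ) (f : Polynomial (lower K x (rank (i, r))))
    (k : ℕ) :
    ∃ t ∈ lower K x (rank (i, r + k + 1)), D^[k + 1] (Polynomial.aeval (x (i, r)) f) =
      Polynomial.aeval (x (i, r)) (Polynomial.derivative f) * x (i, r + k + 1) + t := by
  induction k with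
  | zero => exact deriv_aeval_eq hD hx i r f
  | succ k ih =>
    obtain ⟨t, ht, h⟩ := ih
    set s := Polynomial.aeval (x (i, r)) (Polynomial.derivative f)
    have hs : D s ∈ lower K x (rank (i, r + (k + 1) + 1)) := by
      -- The rank bound amounts to `1 + n ≤ (k + 2) * n`, which needs `n ≥ 1`.
      refine lower_mono x ?_ (deriv_mem_lower hD hx (aeval_mem_lower_succ (i, r) _))
      rw [rank_succ, ← add_assoc r k 1, rank_succ, rank_add]
      have := i.pos
      omega
    refine ⟨D s * x (i, r + k + 1) + D t, add_mem (mul_mem hs (mem_lower x ?_)) ?_, ?_⟩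
    · rw [← add_assoc r k 1, rank_succ i (r + k + 1)]
      exact Nat.lt_add_of_pos_right i.pos
    · rw [show r + (k + 1) + 1 = (r + k + 1) + 1 by ring, rank_succ]
      exact deriv_mem_lower hD hx ht
    · rw [Function.iterate_succ_apply', h, map_add, Derivation.leibniz, hx, smul_eq_mul,
        smul_eq_mul, show r + (k + 1) + 1 = r + k + 1 + 1 by ring]
      ring

/-- Differentiate the previous identity and multiply by `g`: the term that differentiates the power
of `g` is a multiple of that identity. -/
theorem pow_mul_iterate_deriv_eq_zero (D : Derivation ℤ R R) {g z : R} (h : g * z = 0) (k : ℕ) :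
    g ^ (k + 1) * D^[k] z = 0 := by
  induction k with
  | zero => simpa using h
  | succ k ih =>
    have h1 := congrArg (fun y => g * D y) ih
    simp only [Derivation.leibniz, Derivation.leibniz_pow, smul_eq_mul, nsmul_eq_mul, map_zero,
      mul_zero, add_tsub_cancel_right] at h1
    rw [Function.iterate_succ_apply']
    have h2 : g ^ (k + 1 + 1) * D (D^[k] z) +
      (((k + 1 : ℕ) : R) * D g) * (g ^ (k + 1) * D^[k] z) = 0 := by
      rw [← h1]; ring
    rwa [ih, mul_zero, add_zero] at h2

end Derivation

/-! ### Leaders and separable relations -/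

section Algebraic

open IntermediateField

variable {K R F : Type*} [Field K] [CharZero K] [CommRing R] [Algebra K R] [Field F] [Algebra K F]
  (φ : R →ₐ[K] F) {n : ℕ} (x : Fin n × ℕ → R)

/-- The subfield generated by the images of the first `N` variables. -/
def lowerField {K R F : Type*} [Field K] [CommRing R] [Algebra K R] [Field F] [Algebra K F]
    (φ : R →ₐ[K] F) {n : ℕ} (x : Fin n × ℕ → R) (N : ℕ) : IntermediateField K F :=
  IntermediateField.adjoin K ((fun v => φ (x v)) '' {w | rank w < N})

/-- The variable `v` is algebraic over the preceding ones. -/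
def IsLeader {K R F : Type*} [Field K] [CommRing R] [Algebra K R] [Field F] [Algebra K F]
    (φ : R →ₐ[K] F) {n : ℕ} (x : Fin n × ℕ → R) (v : Fin n × ℕ) : Prop :=
  IsAlgebraic (lowerField φ x (rank v)) (φ (x v))

omit [CharZero K] in
theorem lowerField_mono {M N : ℕ} (h : M ≤ N) : lowerField φ x M ≤ lowerField φ x N :=
  IntermediateField.adjoin.mono _ _ _ (Set.image_mono fun _ hw => lt_of_lt_of_le hw h)

omit [CharZero K] in
theorem mem_lowerField {N : ℕ} {v : Fin n × ℕ} (h : rank v < N) :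
    φ (x v) ∈ lowerField φ x N :=
  IntermediateField.subset_adjoin _ _ ⟨v, h, rfl⟩

omit [CharZero K] in
theorem map_lower (N : ℕ) : (lower K x N).map φ =
    Algebra.adjoin K ((fun v => φ (x v)) '' {w | rank w < N}) := by
  rw [lower, AlgHom.map_adjoin, ← Set.image_comp]; rfl

omit [CharZero K] in
theorem map_mem_lowerField {N : ℕ} {a : R} (h : a ∈ lower K x N) : φ a ∈ lowerField φ x N :=
  IntermediateField.algebra_adjoin_le_adjoin K _ (map_lower φ x N ▸ ⟨a, h, rfl⟩)

/-- Descent on the degree: while the derivative also vanishes at `y`, it replaces `f`. If its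
coefficients all die in `F`, characteristic zero leaves only the constant term of `f`, which must
then vanish too. -/
theorem exists_separable_relation_of_natDegree_le {C : Subalgebra K R} {y : R} (d : ℕ)
    (f : Polynomial C) (hd : f.natDegree ≤ d) (hf : ∃ j, φ (f.coeff j) ≠ 0)
    (h0 : φ (Polynomial.aeval y f) = 0) :
    ∃ f : Polynomial C, φ (Polynomial.aeval y f) = 0 ∧
      φ (Polynomial.aeval y (Polynomial.derivative f)) ≠ 0 := by
  have : CharZero F := charZero_of_injective_algebraMap (algebraMap K F).injective
  induction d generalizing f with
  | zero =>
    rw [Polynomial.eq_C_of_natDegree_le_zero hd] at h0 hf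
    obtain ⟨j, hj⟩ := hf
    rw [Polynomial.coeff_C] at hj
    split_ifs at hj
    · simp at h0
      exact absurd h0 hj
    · simp at hj
  | succ d ih =>
    by_cases h : φ (Polynomial.aeval y (Polynomial.derivative f)) = 0
    · by_cases hj : ∃ j, φ ((Polynomial.derivative f).coeff j) ≠ 0
      · exact ih _ ((Polynomial.natDegree_derivative_le f).trans (by omega)) hj h
      · push Not at hj
        exfalso
        have hc : ∀ j, φ (f.coeff (j + 1)) = 0 := fun j => by
          have := hj j
          rw [Polynomial.coeff_derivative] at this
          simpa [Nat.cast_add_one_ne_zero] using this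
        rw [Polynomial.aeval_eq_sum_range, Finset.sum_range_succ', map_add, map_sum,
          Finset.sum_eq_zero (fun j _ => by
            rw [Algebra.smul_def, map_mul, Subalgebra.algebraMap_def,
              Algebra.algebraMap_self_apply, hc, zero_mul])] at h0
        obtain ⟨_ | j, hj⟩ := hf
        · simp [Algebra.smul_def] at h0
          exact hj h0
        · exact hj (hc j)
    · exact ⟨f, h0, h⟩

open scoped IntermediateField.algebraAdjoinAdjoin in
theorem IsLeader.exists_separable_relation {v : Fin n × ℕ} (h : IsLeader φ x v) :
    ∃ f : Polynomial (lower K x (rank v)), φ (Polynomial.aeval (x v) f) = 0 ∧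
      φ (Polynomial.aeval (x v) (Polynomial.derivative f)) ≠ 0 := by
  set S := (fun v => φ (x v)) '' {w | rank w < rank v} with hS
  -- Clearing denominators gives coefficients in the image of `lower`, which then lift to `R`.
  have h1 : IsAlgebraic (Algebra.adjoin K S) (φ (x v)) := by
    rw [IsFractionRing.isAlgebraic_iff (Algebra.adjoin K S) (IntermediateField.adjoin K S) F]
    exact h
  obtain ⟨p, hp, hp0⟩ := h1
  have hm := map_lower φ x (rank v)
  let θ : lower K x (rank v) →+* Algebra.adjoin K S :=
    ((φ.comp (lower K x (rank v)).val).codRestrict (Algebra.adjoin K S) fun a => by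
      rw [hS, ← hm]; exact ⟨a, a.2, rfl⟩).toRingHom
  have hθ : Function.Surjective θ := by
    rintro ⟨a, ha⟩
    rw [hS, ← hm] at ha
    obtain ⟨b, hb, rfl⟩ := ha
    exact ⟨⟨b, hb⟩, rfl⟩
  obtain ⟨f, rfl⟩ := Polynomial.map_surjective θ hθ p
  refine exists_separable_relation_of_natDegree_le φ f.natDegree f le_rfl ?_ ?_
  · by_contra hc
    push Not at hc
    exact hp (Polynomial.ext fun j => by
      rw [Polynomial.coeff_map, Polynomial.coeff_zero]; exact Subtype.ext (hc j))
  · rw [← hp0, Polynomial.aeval_def, Polynomial.aeval_def, Polynomial.eval₂_map,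
      ← AlgHom.coe_toRingHom, Polynomial.hom_eval₂]
    rfl

end Algebraic

/-! ### Finite generation when every `x_i` has a leader -/

section Generation

variable {K R F : Type*} [Field K] [CommRing R] [Algebra K R] [Field F] [Algebra K F]
  {n : ℕ} {x : Fin n × ℕ → R}

theorem IsLeader.exists_relation [CharZero K] {φ : R →ₐ[K] F} {D : Derivation ℤ R R}
    (hD : ∀ a : K, ∃ b : K, D (algebraMap K R a) = algebraMap K R b)
    (hx : ∀ i r, D (x (i, r)) = x (i, r + 1))
    (hker : ∀ z, φ z = 0 → ∃ g, φ g ≠ 0 ∧ g * z = 0) {i : Fin n} {r : ℕ}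
    (h : IsLeader φ x (i, r)) :
    ∃ S g : R, S ∈ lower K x (rank (i, r) + 1) ∧ φ S ≠ 0 ∧ φ g ≠ 0 ∧
      ∀ k, ∃ t ∈ lower K x (rank (i, r + k + 1)),
        g ^ (k + 2) * (S * x (i, r + k + 1) + t) = 0 := by
  obtain ⟨f, hf, hf'⟩ := h.exists_separable_relation
  obtain ⟨g, hg, hgf⟩ := hker _ hf
  refine ⟨_, g, aeval_mem_lower_succ (i, r) (Polynomial.derivative f), hf', hg, fun k => ?_⟩
  obtain ⟨t, ht, hk⟩ := iterate_deriv_aeval_eq hD hx i r f k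
  exact ⟨t, ht, hk ▸ pow_mul_iterate_deriv_eq_zero D hgf (k + 1)⟩

theorem map_lower_le {Q : Type*} [CommRing Q] [Algebra K Q] (ψ : R →ₐ[K] Q) (Z : Subalgebra K Q)
    {N : ℕ} (h : ∀ v, rank v < N → ψ (x v) ∈ Z) {a : R} (ha : a ∈ lower K x N) : ψ a ∈ Z := by
  have hle : lower K x N ≤ Z.comap ψ := by
    refine Algebra.adjoin_le ?_
    rintro _ ⟨v, hv, rfl⟩
    exact h v hv
  exact hle ha

/-- Induction on the rank: solve the linear relation for `x v`. It serves both for a localization of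
`R` and for a subring of `F`. -/
theorem map_mem_of_relations {Q : Type*} [CommRing Q] [Algebra K Q] (ψ : R →ₐ[K] Q)
    (Z : Subalgebra K Q)
    (H : ∀ v, ψ (x v) ∈ Z ∨ ∃ S, ∃ t ∈ lower K x (rank v), ∃ g, IsUnit (ψ g) ∧
      g * (S * x v + t) = 0 ∧ ∃ s ∈ Z, s * ψ S = 1) (v : Fin n × ℕ) :
    ψ (x v) ∈ Z := by
  obtain ⟨N, hN⟩ : ∃ N, rank v = N := ⟨_, rfl⟩
  induction N using Nat.strong_induction_on generalizing v with
  | _ N ih =>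
    have hlow : ∀ w, rank w < rank v → ψ (x w) ∈ Z := fun w hw => ih _ (hN ▸ hw) w rfl
    obtain h | ⟨S, t, ht, g, hg, h0, s, hs, hsS⟩ := H v
    · exact h
    · have h1 : ψ S * ψ (x v) + ψ t = 0 := by
        have := congrArg ψ h0
        rw [map_mul, map_zero, hg.mul_right_eq_zero] at this
        simpa using this
      have h2 : ψ (x v) = -(s * ψ t) := by
        linear_combination s * h1 - ψ (x v) * hsS
      rw [h2]
      exact neg_mem (mul_mem hs (map_lower_le ψ Z hlow ht))

theorem finiteType_away_of_isLeader [CharZero K] {φ : R →ₐ[K] F} {D : Derivation ℤ R R}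
    (hD : ∀ a : K, ∃ b : K, D (algebraMap K R a) = algebraMap K R b)
    (hx : ∀ i r, D (x (i, r)) = x (i, r + 1)) (hgen : Algebra.adjoin K (Set.range x) = ⊤)
    (hker : ∀ z, φ z = 0 → ∃ g, φ g ≠ 0 ∧ g * z = 0)
    (H : ∀ i, ∃ r, IsLeader φ x (i, r)) :
    ∃ f : R, φ f ≠ 0 ∧ Algebra.FiniteType K (Localization.Away f) := by
  choose r hr using H
  choose S g _ hSφ hgφ hrel using fun i => (hr i).exists_relation hD hx hker
  set f : R := ∏ i, S i * g i with hf
  refine ⟨f, by simp [hf, Finset.prod_ne_zero_iff, hSφ, hgφ], ?_⟩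
  set Q := Localization.Away f
  let ψ : R →ₐ[K] Q := IsScalarTower.toAlgHom K R Q
  have hfu : IsUnit (ψ f) := IsLocalization.Away.algebraMap_isUnit f
  have hSg : ∀ i, IsUnit (ψ (S i)) ∧ IsUnit (ψ (g i)) := fun i => by
    have : IsUnit (ψ (S i * g i)) :=
      isUnit_of_dvd_unit (map_dvd ψ
        (Finset.dvd_prod_of_mem (fun i => S i * g i) (Finset.mem_univ i))) hfu
    rwa [map_mul, IsUnit.mul_iff] at this
  choose s hs using fun i => (hSg i).1.exists_left_inv
  set G : Set Q := (fun v => ψ (x v)) '' {v : Fin n × ℕ | v.2 ≤ r v.1} ∪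
    (Set.range s ∪ {IsLocalization.Away.invSelf f}) with hG
  have hfin : G.Finite := by
    refine Set.Finite.union (Set.Finite.image _ ?_)
      ((Set.finite_range s).union (Set.finite_singleton _))
    refine (Set.finite_univ.prod (Set.finite_le_nat (∑ i, r i))).subset fun v hv => ?_
    exact ⟨trivial, le_trans hv (Finset.single_le_sum (f := r) (fun _ _ => Nat.zero_le _)
      (Finset.mem_univ v.1))⟩
  have hZ : ∀ v, ψ (x v) ∈ Algebra.adjoin K G := by
    refine map_mem_of_relations ψ _ fun ⟨i, m⟩ => ?_
    by_cases hm : m ≤ r i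
    · exact Or.inl (Algebra.subset_adjoin (Or.inl ⟨(i, m), hm, rfl⟩))
    · obtain ⟨k, rfl⟩ : ∃ k, m = r i + k + 1 := ⟨m - r i - 1, by omega⟩
      obtain ⟨t, ht, h0⟩ := hrel i k
      refine Or.inr ⟨S i, t, ht, g i ^ (k + 2), ?_, h0, s i,
        Algebra.subset_adjoin (Or.inr (Or.inl ⟨i, rfl⟩)), hs i⟩
      rw [map_pow]
      exact (hSg i).2.pow _
  have hR : ∀ a, ψ a ∈ Algebra.adjoin K G := fun a => by
    have hle : Algebra.adjoin K (Set.range x) ≤ (Algebra.adjoin K G).comap ψ := by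
      refine Algebra.adjoin_le ?_
      rintro _ ⟨v, rfl⟩
      exact hZ v
    exact hle (hgen ▸ Algebra.mem_top)
  refine ⟨Subalgebra.fg_def.2 ⟨G, hfin, Algebra.eq_top_iff.2 fun q => ?_⟩⟩
  obtain ⟨m, a, hq⟩ := IsLocalization.Away.surj f q
  have : q = ψ a * IsLocalization.Away.invSelf f ^ m := by
    have h1 : algebraMap R Q f ^ m * (IsLocalization.Away.invSelf f : Q) ^ m = 1 := by
      rw [← mul_pow, IsLocalization.Away.mul_invSelf, one_pow]
    calc q = q * (algebraMap R Q f ^ m * (IsLocalization.Away.invSelf f : Q) ^ m) := by rw [h1, mul_one]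
      _ = _ := by rw [← mul_assoc, hq]; rfl
  have hinv : (IsLocalization.Away.invSelf f : Q) ∈ Algebra.adjoin K G :=
    Algebra.subset_adjoin (Or.inr (Or.inr rfl))
  rw [this]
  exact mul_mem (hR a) (pow_mem hinv m)

end Generation

/-! ### Infinite dimension when some `x_i` has no leader -/

section Dimension

/-- Every element of `Z` is a fraction of images from `A`, so a prime of `Z` is determined by its
contraction. -/
theorem _root_.ringKrullDim_le_of_forall_exists_isUnit_mul_eq {A Z : Type*} [CommRing A]
    [CommRing Z] (φ : A →+* Z) (H : ∀ z, ∃ a s, IsUnit (φ s) ∧ φ s * z = φ a) :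
    ringKrullDim Z ≤ ringKrullDim A := by
  have hle : ∀ p q : PrimeSpectrum Z, PrimeSpectrum.comap φ p ≤ PrimeSpectrum.comap φ q →
      p ≤ q := by
    intro p q h z hz
    obtain ⟨a, s, hs, hz'⟩ := H z
    have ha : a ∈ (PrimeSpectrum.comap φ p).asIdeal := by
      change φ a ∈ p.asIdeal
      rw [← hz']
      exact Ideal.mul_mem_left _ _ hz
    have hq : φ a ∈ q.asIdeal := h ha
    rw [← hz'] at hq
    exact (Ideal.unit_mul_mem_iff_mem _ hs).1 hq
  have hmono : Monotone (PrimeSpectrum.comap φ) := fun p q h => Ideal.comap_mono h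
  refine Order.krullDim_le_of_strictMono (PrimeSpectrum.comap φ) fun p q h => ?_
  exact lt_of_le_not_ge (hmono h.le) fun h' => h.not_ge (hle _ _ h')

variable {K R F : Type*} [Field K] [CommRing R] [Algebra K R] [Field F] [Algebra K F]
  {n : ℕ} (φ : R →ₐ[K] F) (x : Fin n × ℕ → R)

theorem algebraicIndependent_of_not_isLeader (N : ℕ) :
    AlgebraicIndependent (lowerField φ x N)
      (fun v : {v : Fin n × ℕ | N ≤ rank v ∧ ¬ IsLeader φ x v} => φ (x v)) := by
  classical
  set L := lowerField φ x N
  set T := {v : Fin n × ℕ | N ≤ rank v ∧ ¬ IsLeader φ x v}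
  refine algebraicIndependent_of_finite_type fun t ht => ?_
  lift t to Finset T using ht
  change AlgebraicIndepOn L (fun v : T => φ (x v)) (t : Set T)
  -- Adding variables by increasing rank, the new one is transcendental over a field containing `L`
  -- and all those already present.
  induction t using Finset.induction_on_max_value (fun v : T => rank (v : Fin n × ℕ)) with
  | empty =>
    rw [Finset.coe_empty]
    exact algebraicIndependent_empty_type_iff.mpr (algebraMap L F).injective
  | insert v s hv hmax ih =>
    rw [Finset.coe_insert]
    refine ih.insert fun halg => v.2.2 ?_
    set M := lowerField φ x (rank (v : Fin n × ℕ))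
    set A := Algebra.adjoin L ((fun v : T => φ (x v)) '' (s : Set T))
    have hAM : ∀ a ∈ A, a ∈ M := by
      intro a ha
      induction ha using Algebra.adjoin_induction with
      | mem a ha =>
        obtain ⟨w, hw, rfl⟩ := ha
        refine mem_lowerField φ x (lt_of_le_of_ne (hmax w hw) fun h => hv ?_)
        have := Subtype.ext (rank_injective h)
        exact this ▸ hw
      | algebraMap a => exact lowerField_mono φ x v.2.1 a.2
      | add a b _ _ ha hb => exact add_mem ha hb
      | mul a b _ _ ha hb => exact mul_mem ha hb
    let j : A →+* M := (Subring.inclusion (S := A.toSubring) (T := M.toSubfield.toSubring) hAM)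
    refine halg.ringHom_of_comp_eq j (RingHom.id F) (fun a b h => ?_) rfl
    exact Subtype.ext (congrArg (fun y : M => (y : F)) h)

theorem exists_mul_eq_map_of_mem_lowerField (N : ℕ) {l : F} (hl : l ∈ lowerField φ x N) :
    ∃ s ∈ lower K x N, φ s ≠ 0 ∧ ∃ a, φ s * l = φ a := by
  obtain ⟨a, ha, b, hb, rfl⟩ := IntermediateField.mem_adjoin_iff_div.1 hl
  rw [← map_lower] at ha hb
  obtain ⟨a, ha, rfl⟩ := ha
  obtain ⟨b, hb, rfl⟩ := hb
  change ∃ s ∈ lower K x N, φ s ≠ 0 ∧ ∃ c, φ s * (φ a / φ b) = φ c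
  by_cases h : φ b = 0
  · exact ⟨1, one_mem _, by simp, 0, by simp [h]⟩
  · exact ⟨b, hb, h, a, mul_div_cancel₀ _ h⟩

/-- Taking the denominator in `lower K x N` makes its image a unit of `lowerField φ x N`, hence of
the adjoined algebra. -/
theorem exists_mul_eq_map_of_mem_adjoin (N : ℕ) {ι : Type*} {y : ι → R} {z : F}
    (hz : z ∈ Algebra.adjoin (lowerField φ x N) (Set.range fun v => φ (y v))) :
    ∃ s ∈ lower K x N, φ s ≠ 0 ∧ ∃ a, φ s * z = φ a := by
  induction hz using Algebra.adjoin_induction with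
  | mem z hz =>
    obtain ⟨v, rfl⟩ := hz
    exact ⟨1, one_mem _, by simp, y v, by simp⟩
  | algebraMap l => exact exists_mul_eq_map_of_mem_lowerField φ x N l.2
  | add y z _ _ hy hz =>
    obtain ⟨s, hs, hs0, a, ha⟩ := hy
    obtain ⟨t, ht, ht0, b, hb⟩ := hz
    refine ⟨s * t, mul_mem hs ht, by simp [hs0, ht0], t * a + s * b, ?_⟩
    simp only [map_mul, map_add, ← ha, ← hb]
    ring
  | mul y z _ _ hy hz =>
    obtain ⟨s, hs, hs0, a, ha⟩ := hy
    obtain ⟨t, ht, ht0, b, hb⟩ := hz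
    refine ⟨s * t, mul_mem hs ht, by simp [hs0, ht0], a * b, ?_⟩
    simp only [map_mul, ← ha, ← hb]
    ring

theorem ringKrullDim_eq_top_of_not_isLeader [CharZero K] {φ : R →ₐ[K] F} {x : Fin n × ℕ → R}
    {D : Derivation ℤ R R}
    (hD : ∀ a : K, ∃ b : K, D (algebraMap K R a) = algebraMap K R b)
    (hx : ∀ i r, D (x (i, r)) = x (i, r + 1)) (hgen : Algebra.adjoin K (Set.range x) = ⊤)
    (hker : ∀ z, φ z = 0 → ∃ g, φ g ≠ 0 ∧ g * z = 0)
    (H : ¬ ∀ i, ∃ r, IsLeader φ x (i, r)) {J : Ideal R} (hJ : J ≤ RingHom.ker φ) :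
    ringKrullDim (R ⧸ J) = ⊤ := by
  classical
  push Not at H
  obtain ⟨i₀, hi₀⟩ := H
  -- `N` lies beyond one leader for each index that has any, so the separants of these leaders
  -- become units in `L`.
  obtain ⟨N, hN⟩ : ∃ N, ∀ i, (∃ r, IsLeader φ x (i, r)) →
      ∃ r, IsLeader φ x (i, r) ∧ rank (i, r) < N := by
    have : ∀ i, ∃ m, (∃ r, IsLeader φ x (i, r)) → ∃ r, IsLeader φ x (i, r) ∧ rank (i, r) < m := by
      intro i
      by_cases h : ∃ r, IsLeader φ x (i, r)
      · exact ⟨rank (i, h.choose) + 1, fun _ => ⟨_, h.choose_spec, Nat.lt_succ_self _⟩⟩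
      · exact ⟨0, fun h' => absurd h' h⟩
    choose m hm using this
    refine ⟨∑ i, m i, fun i hi => ?_⟩
    obtain ⟨r, hr, hlt⟩ := hm i hi
    exact ⟨r, hr, hlt.trans_le (Finset.single_le_sum (f := m) (fun _ _ => Nat.zero_le _)
      (Finset.mem_univ i))⟩
  set L := lowerField φ x N with hL
  set T := {v : Fin n × ℕ | N ≤ rank v ∧ ¬ IsLeader φ x v} with hT
  have hind : AlgebraicIndependent L (fun v : T => φ (x v)) :=
    algebraicIndependent_of_not_isLeader φ x N
  have hTinf : Infinite T := by
    refine Infinite.of_injective (fun k : ℕ => (⟨(i₀, N + k), ?_, hi₀ _⟩ : T)) fun a b h => ?_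
    · have := i₀.pos
      simp only [rank]
      nlinarith
    · simpa using h
  set Z := Algebra.adjoin L (Set.range fun v : T => φ (x v)) with hZ
  have hdimZ : ringKrullDim Z = ⊤ := by
    rw [← ringKrullDim_eq_of_ringEquiv hind.aevalEquiv.toRingEquiv]
    have h := ringKrullDim_add_enatCard_le_ringKrullDim_mvPolynomial (R := L) T
    rw [ringKrullDim_eq_zero_of_field, zero_add, ENat.card_eq_top_of_infinite] at h
    exact top_le_iff.1 h
  have hLZ : ∀ a ∈ L, a ∈ Z := fun a ha => Z.algebraMap_mem ⟨a, ha⟩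
  have hTZ : ∀ v : T, φ (x v) ∈ Z := fun v => Algebra.subset_adjoin (Set.mem_range_self v)
  have hxZ : ∀ v, φ (x v) ∈ Z.restrictScalars K := by
    refine map_mem_of_relations φ _ fun ⟨i, m⟩ => ?_
    by_cases hm : rank (i, m) < N
    · exact Or.inl (hLZ _ (mem_lowerField φ x hm))
    by_cases hl : IsLeader φ x (i, m)
    -- The relation used comes from the leader of rank below `N`, of which this variable is a proper
    -- derivative.
    · obtain ⟨r, hr, hrN⟩ := hN i ⟨m, hl⟩
      obtain ⟨S, g, hS, hSφ, hgφ, hrel⟩ := hr.exists_relation hD hx hker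
      have hrm : r < m := by
        by_contra h
        have : rank (i, m) ≤ rank (i, r) := by
          simp only [rank]
          gcongr
          omega
        omega
      obtain ⟨k, rfl⟩ : ∃ k, m = r + k + 1 := ⟨m - r - 1, by omega⟩
      obtain ⟨t, ht, h0⟩ := hrel k
      have hSN : S ∈ lower K x N := lower_mono x hrN hS
      refine Or.inr ⟨S, t, ht, g ^ (k + 2), ?_, h0, (φ S)⁻¹, ?_,
        inv_mul_cancel₀ hSφ⟩
      · rw [map_pow]
        exact (isUnit_iff_ne_zero.2 hgφ).pow _
      · exact hLZ _ (inv_mem (map_mem_lowerField φ x hSN))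
    · exact Or.inl (hTZ ⟨(i, m), not_lt.1 hm, hl⟩)
  have hRZ : ∀ a, φ a ∈ Z := fun a => by
    have hle : Algebra.adjoin K (Set.range x) ≤ (Z.restrictScalars K).comap φ := by
      refine Algebra.adjoin_le ?_
      rintro _ ⟨v, rfl⟩
      exact hxZ v
    exact hle (hgen ▸ Algebra.mem_top)
  have hfrac : ∀ z ∈ Z, ∃ s ∈ lower K x N, φ s ≠ 0 ∧ ∃ a, φ s * z = φ a :=
    fun z hz => exists_mul_eq_map_of_mem_adjoin φ x N hz
  let θ : R →+* Z := φ.toRingHom.codRestrict Z.toSubring hRZ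
  have hθ : ∀ a ∈ J, θ a = 0 := fun a ha => Subtype.ext (hJ ha)
  refine top_le_iff.1 (hdimZ ▸ ringKrullDim_le_of_forall_exists_isUnit_mul_eq
    (Ideal.Quotient.lift J θ hθ) fun z => ?_)
  obtain ⟨s, hs, hs0, a, ha⟩ := hfrac z z.2
  refine ⟨Ideal.Quotient.mk J a, Ideal.Quotient.mk J s, ?_, Subtype.ext ha⟩
  rw [Ideal.Quotient.lift_mk]
  refine IsUnit.of_mul_eq_one ⟨(φ s)⁻¹, hLZ _ (inv_mem (map_mem_lowerField φ x hs))⟩ ?_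
  exact Subtype.ext (mul_inv_cancel₀ hs0)

end Dimension

/-! ### Generic smoothness -/

section Smooth

theorem isField_localization_atPrime {C : Type*} [CommRing C] (q : Ideal C) [q.IsPrime]
    (H : ∀ z ∈ q, ∃ g ∉ q, g * z = 0) : IsField (Localization.AtPrime q) := by
  rw [IsLocalRing.isField_iff_maximalIdeal_eq, ← Localization.AtPrime.map_eq_maximalIdeal,
    Ideal.map_eq_bot_iff_le_ker]
  intro z hz
  obtain ⟨g, hg, h⟩ := H z hz
  exact (IsLocalization.map_eq_zero_iff q.primeCompl _ z).2 ⟨⟨g, hg⟩, h⟩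

theorem exists_smooth_away {K C : Type w} [Field K] [CharZero K] [CommRing C] [Algebra K C]
    [Algebra.FiniteType K C] (q : Ideal C) [q.IsPrime] (H : ∀ z ∈ q, ∃ g ∉ q, g * z = 0) :
    ∃ f ∉ q, Algebra.Smooth K (Localization.Away f) := by
  have : Algebra.FinitePresentation K C := Algebra.FinitePresentation.of_finiteType.1 inferInstance
  have : Algebra.IsSmoothAt K q := by
    -- The local ring is a field essentially of finite type over the perfect field `K`, hence
    -- formally smooth.
    let : Field (Localization.AtPrime q) := (isField_localization_atPrime q H).toField
    have : Algebra.EssFiniteType K (Localization.AtPrime q) :=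
      .comp K C (Localization.AtPrime q)
    exact Algebra.FormallySmooth.of_perfectField
  exact Algebra.IsSmoothAt.exists_notMem_smooth K q

/-- Annihilators found in `R` still annihilate in the quotient, so any `J` inside `ker φ` is
allowed, whatever the closed subscheme structure. -/
theorem exists_smooth_away_quotient {K R F : Type w} [Field K] [CharZero K] [CommRing R]
    [Algebra K R] [Field F] [Algebra K F] (φ : R →ₐ[K] F)
    (hker : ∀ z, φ z = 0 → ∃ g, φ g ≠ 0 ∧ g * z = 0) {f : R} (hf : φ f ≠ 0)
    [Algebra.FiniteType K (Localization.Away f)] {J : Ideal R} (hJ : J ≤ RingHom.ker φ) :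
    ∃ h : Localization.Away (Ideal.Quotient.mk J f),
      ¬ IsNilpotent h ∧ Algebra.Smooth K (Localization.Away h) := by
  set C := Localization.Away (Ideal.Quotient.mk J f)
  have : Algebra.FiniteType K C := by
    refine Algebra.FiniteType.of_surjective
      (Localization.awayMapₐ (Ideal.Quotient.mkₐ K J) f) ?_
    change Function.Surjective (Localization.awayMap (Ideal.Quotient.mk J) f)
    exact Localization.awayMap_surjective_iff.2 fun a => by
      obtain ⟨a, rfl⟩ := Ideal.Quotient.mk_surjective a
      exact ⟨a, 0, by simp⟩
  let θ : R ⧸ J →+* F := Ideal.Quotient.lift J φ.toRingHom hJ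
  have hθ : ∀ a, θ (Ideal.Quotient.mk J a) = φ a := fun a => rfl
  let χ : C →+* F := IsLocalization.Away.lift (Ideal.Quotient.mk J f) (g := θ)
    (isUnit_iff_ne_zero.2 hf)
  have hχ : ∀ a, χ (algebraMap _ C (Ideal.Quotient.mk J a)) = φ a := fun a =>
    IsLocalization.Away.lift_eq _ _ _
  have : (RingHom.ker χ).IsPrime := RingHom.ker_isPrime χ
  obtain ⟨h, hh, hs⟩ := exists_smooth_away (K := K) (RingHom.ker χ) (fun z hz => by
    obtain ⟨m, a, ha⟩ := IsLocalization.Away.surj (Ideal.Quotient.mk J f) z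
    obtain ⟨a, rfl⟩ := Ideal.Quotient.mk_surjective a
    have ha0 : φ a = 0 := by
      rw [← hχ, ← ha, map_mul, (RingHom.mem_ker).1 hz, zero_mul]
    obtain ⟨g, hg, hga⟩ := hker a ha0
    refine ⟨algebraMap _ C (Ideal.Quotient.mk J g), fun h => hg (by rw [← hχ]; exact h), ?_⟩
    have hu : IsUnit (algebraMap (R ⧸ J) C (Ideal.Quotient.mk J f) ^ m) :=
      (IsLocalization.Away.algebraMap_isUnit _).pow m
    rw [← hu.mul_left_eq_zero, mul_assoc, ha, ← map_mul, ← map_mul, hga, map_zero, map_zero])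
  refine ⟨h, fun hn => hh ?_, hs⟩
  exact (hn.map χ).eq_zero

end Smooth

/-! ### From algebras to open subschemes -/

section Scheme

theorem exists_opens_smooth {K B : Type w} [Field K] [CommRing B] [Algebra K B] {X : Scheme.{w}}
    (e : X ≅ Spec (.of B)) (π : X ⟶ Spec (.of K))
    (hπ : π = e.hom ≫ Spec.map (CommRingCat.ofHom (algebraMap K B))) (f : B)
    (h : Localization.Away f) (hn : ¬ IsNilpotent h) [Algebra.Smooth K (Localization.Away h)] :
    ∃ U : X.Opens, (U : Set X).Nonempty ∧ LocallyOfFiniteType (U.ι ≫ π) ∧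
      QuasiCompact (U.ι ≫ π) ∧ Smooth (U.ι ≫ π) := by
  let j : Spec (.of (Localization.Away h)) ⟶ X :=
    Spec.map (CommRingCat.ofHom (algebraMap (Localization.Away f) (Localization.Away h))) ≫
      Spec.map (CommRingCat.ofHom (algebraMap B (Localization.Away f))) ≫ e.inv
  have hcomp : j.opensRange.ι ≫ π = j.isoOpensRange.inv ≫
      Spec.map (CommRingCat.ofHom (algebraMap K (Localization.Away h))) := by
    rw [← Scheme.Hom.isoOpensRange_inv_comp, hπ, Category.assoc]
    congr 1
    simp only [j, Category.assoc, Iso.inv_hom_id_assoc, ← Spec.map_comp, ← CommRingCat.ofHom_comp]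
  have hsm : Smooth (Spec.map (CommRingCat.ofHom (algebraMap K (Localization.Away h)))) := by
    rw [HasRingHomProperty.Spec_iff (P := @Smooth)]
    exact RingHom.smooth_algebraMap.2 inferInstance
  refine ⟨j.opensRange, ?_, ?_, ?_, ?_⟩
  · have : Nontrivial (Localization.Away h) := by
      rw [← not_subsingleton_iff_nontrivial]
      intro hs
      have := (IsLocalization.subsingleton_iff (S := Localization.Away h)
        (M := Submonoid.powers h)).1 hs
      exact hn this
    obtain ⟨y⟩ : Nonempty (PrimeSpectrum (Localization.Away h)) := inferInstance
    exact ⟨j y, y, rfl⟩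
  · rw [hcomp]; infer_instance
  · rw [hcomp]; infer_instance
  · rw [hcomp]; infer_instance

end Scheme

/-! ### The derivation on the quotient ring -/

section Quotient

variable {K : Type*} [CommRing K] [Differential K] {n e : ℕ} (u : Fin e → DiffPoly K n)

theorem deriv_mem_diffIdeal {f : DiffPoly K n} (hf : f ∈ diffIdeal u) : f′ ∈ diffIdeal u := by
  unfold diffIdeal at hf
  induction hf using Submodule.span_induction with
  | mem f hf =>
    obtain ⟨i, j, rfl⟩ := hf
    exact Ideal.subset_span ⟨i, j + 1, (Function.iterate_succ_apply' _ _ _).symm⟩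
  | zero => rw [map_zero]; exact zero_mem _
  | add f g _ _ hf hg => rw [map_add]; exact add_mem hf hg
  | smul a f hf' hf =>
    rw [smul_eq_mul, Derivation.leibniz, smul_eq_mul, smul_eq_mul]
    exact add_mem (Ideal.mul_mem_left _ _ hf) (Ideal.mul_mem_right _ _ hf')

/-- The derivation of `K{x₁, …, xₙ}/[u₁, …, uₑ]`. -/
noncomputable def quotientDeriv :
    Derivation ℤ (DiffPoly K n ⧸ diffIdeal u) (DiffPoly K n ⧸ diffIdeal u) :=
  Derivation.mk'
    (AddMonoidHom.toIntLinearMap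
      (QuotientAddGroup.map (diffIdeal u).toAddSubgroup (diffIdeal u).toAddSubgroup
        (Differential.deriv (R := DiffPoly K n)).toLinearMap.toAddMonoidHom
        fun _ hf => deriv_mem_diffIdeal u hf))
    (fun a b => by
      obtain ⟨a, rfl⟩ := Ideal.Quotient.mk_surjective a
      obtain ⟨b, rfl⟩ := Ideal.Quotient.mk_surjective b
      change Ideal.Quotient.mk (diffIdeal u) (a * b)′ = Ideal.Quotient.mk (diffIdeal u) a *
        Ideal.Quotient.mk (diffIdeal u) b′ + Ideal.Quotient.mk (diffIdeal u) b *
        Ideal.Quotient.mk (diffIdeal u) a′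
      rw [Derivation.leibniz]
      simp)

theorem quotientDeriv_mk (f : DiffPoly K n) :
    quotientDeriv u (Ideal.Quotient.mk _ f) = Ideal.Quotient.mk _ f′ := rfl

/-- The class of `x_i^{(r)}` in `K{x₁, …, xₙ}/[u₁, …, uₑ]`. -/
noncomputable def quotientVar (v : Fin n × ℕ) : DiffPoly K n ⧸ diffIdeal u :=
  Ideal.Quotient.mk _ (MvPolynomial.X v)

theorem quotientDeriv_quotientVar (i : Fin n) (r : ℕ) :
    quotientDeriv u (quotientVar u (i, r)) = quotientVar u (i, r + 1) := by
  rw [quotientVar, quotientDeriv_mk, deriv_X, quotientVar]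

theorem quotientDeriv_algebraMap (a : K) :
    quotientDeriv u (algebraMap K _ a) = algebraMap K _ a′ := by
  change quotientDeriv u (Ideal.Quotient.mk _ (MvPolynomial.C a)) = _
  rw [quotientDeriv_mk, deriv_C]
  rfl

theorem adjoin_range_quotientVar : Algebra.adjoin K (Set.range (quotientVar u)) = ⊤ := by
  have h := congrArg (Subalgebra.map (Ideal.Quotient.mkₐ K (diffIdeal u)))
    (MvPolynomial.adjoin_range_X (R := K) (σ := Fin n × ℕ))
  rw [AlgHom.map_adjoin, ← Set.range_comp, Algebra.map_top,
    (AlgHom.range_eq_top _).2 (Ideal.Quotient.mkₐ_surjective K _)] at h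
  exact h

end Quotient

/-! ### Reducedness at the generic point -/

section GenericPoint

/-- At a minimal prime the maximal ideal of the local ring is its nilradical, hence zero here. -/
theorem exists_notMem_mul_eq_zero {R : Type*} [CommRing R] {p : Ideal R} [p.IsPrime]
    (hp : p ∈ minimalPrimes R) [_root_.IsReduced (Localization.AtPrime p)] {z : R} (hz : z ∈ p) :
    ∃ g ∉ p, g * z = 0 := by
  have h : algebraMap R (Localization.AtPrime p) z ∈
      (Ideal.map (algebraMap R (Localization.AtPrime p)) ⊥).radical := by
    rw [IsLocalization.AtPrime.radical_map_of_mem_minimalPrimes _ p ⊥ hp]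
    exact Ideal.mem_map_of_mem _ hz
  rw [Ideal.map_bot] at h
  have h0 : algebraMap R (Localization.AtPrime p) z = 0 := by
    obtain ⟨m, hm⟩ := h
    exact IsReduced.eq_zero _ ⟨m, hm⟩
  obtain ⟨⟨g, hg⟩, h1⟩ := (IsLocalization.map_eq_zero_iff p.primeCompl _ z).1 h0
  exact ⟨g, hg, h1⟩

theorem asIdeal_mem_minimalPrimes {R : Type*} [CommRing R] {s : Set (PrimeSpectrum R)}
    (hs : s ∈ irreducibleComponents (PrimeSpectrum R)) {η : PrimeSpectrum R}
    (hη : IsGenericPoint η s) : η.asIdeal ∈ minimalPrimes R := by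
  rw [← PrimeSpectrum.vanishingIdeal_singleton, PrimeSpectrum.vanishingIdeal_mem_minimalPrimes]
  rwa [hη.def]

end GenericPoint
end DiffPoly

theorem mainTheorem5 {K : Type w} [Field K] [CharZero K] [Differential K] {n : ℕ}
    (u : Fin n → DiffPoly K n)
    -- the component, as a closed subscheme of the differential scheme
    (Sigma1 : Scheme.{w}) (i : Sigma1 ⟶ diffScheme u) [IsClosedImmersion i]
    (hcomp : Set.range i ∈ irreducibleComponents (diffScheme u))
    -- the local ring at its generic point is reduced
    (η : diffScheme u) (hη : IsGenericPoint η (Set.range i))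
    (hred : _root_.IsReduced ((diffScheme u).presheaf.stalk η))
    -- finite Krull dimension
    (hdim : topologicalKrullDim Sigma1 < ⊤) :
    ∃ U' U : Sigma1.Opens, U' ≤ U ∧ (U' : Set Sigma1).Nonempty ∧
      LocallyOfFiniteType (U.ι ≫ i ≫ diffScheme.toSpec u) ∧
      QuasiCompact (U.ι ≫ i ≫ diffScheme.toSpec u) ∧
      Smooth (U'.ι ≫ i ≫ diffScheme.toSpec u) := by
  let R := DiffPoly K n ⧸ DiffPoly.diffIdeal u
  let p : PrimeSpectrum R := η
  have : _root_.IsReduced (Localization.AtPrime p.asIdeal) :=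
    have : _root_.IsReduced ((Spec (.of R)).presheaf.stalk p) := hred
    isReduced_of_injective (Spec.stalkIso (.of R) p).inv.hom
      (Spec.stalkIso (.of R) p).symm.commRingCatIsoToRingEquiv.injective
  have hmin : p.asIdeal ∈ minimalPrimes R := DiffPoly.asIdeal_mem_minimalPrimes hcomp hη
  obtain ⟨J, e, he⟩ := (IsClosedImmersion.Spec_iff (R := .of R) (f := i)).1 ‹_›
  let φ : R →ₐ[K] p.asIdeal.ResidueField := IsScalarTower.toAlgHom K R _
  have hφ : ∀ z, φ z = 0 ↔ z ∈ p.asIdeal := fun z => by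
    exact Ideal.algebraMap_residueField_eq_zero
  have hker : ∀ z, φ z = 0 → ∃ g, φ g ≠ 0 ∧ g * z = 0 := fun z hz => by
    obtain ⟨g, hg, h⟩ := DiffPoly.exists_notMem_mul_eq_zero hmin ((hφ z).1 hz)
    exact ⟨g, fun h => hg ((hφ g).1 h), h⟩
  have hJ : J ≤ RingHom.ker φ := by
    obtain ⟨y, hy⟩ : η ∈ Set.range i := hη.mem
    intro a ha
    refine (hφ a).2 ?_
    have hp : p = PrimeSpectrum.comap (Ideal.Quotient.mk J) (e.hom y) := by
      rw [← show i y = p from hy, he]; rfl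
    rw [hp]
    change Ideal.Quotient.mk J a ∈ (e.hom y).asIdeal
    rw [Ideal.Quotient.eq_zero_iff_mem.2 ha]
    exact zero_mem _
  have hdimJ : ringKrullDim (R ⧸ J) ≠ ⊤ := by
    rw [← PrimeSpectrum.topologicalKrullDim_eq_ringKrullDim]
    rw [IsHomeomorph.topologicalKrullDim_eq _ (Scheme.homeoOfIso e).isHomeomorph] at hdim
    exact hdim.ne
  have hD : ∀ a : K, ∃ b : K, DiffPoly.quotientDeriv u (algebraMap K R a) = algebraMap K R b :=
    fun a => ⟨a′, DiffPoly.quotientDeriv_algebraMap u a⟩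
  have hx := DiffPoly.quotientDeriv_quotientVar u
  have hgen := DiffPoly.adjoin_range_quotientVar u
  have hlead : ∀ i, ∃ r, DiffPoly.IsLeader φ (DiffPoly.quotientVar u) (i, r) := by
    by_contra H
    exact hdimJ (DiffPoly.ringKrullDim_eq_top_of_not_isLeader hD hx hgen hker H hJ)
  obtain ⟨f, hf, hft⟩ := DiffPoly.finiteType_away_of_isLeader hD hx hgen hker hlead
  obtain ⟨h, hn, hs⟩ := DiffPoly.exists_smooth_away_quotient φ hker hf hJ
  obtain ⟨U, hU, h1, h2, h3⟩ := DiffPoly.exists_opens_smooth e (i ≫ diffScheme.toSpec u)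
    (by
      rw [he]
      exact (Category.assoc e.hom _ _).trans (congrArg (e.hom ≫ ·) (Spec.map_comp _ _).symm))
    _ h hn
  -- The smooth open subset is already of finite type, so it serves as both `U'` and `U`.
  exact ⟨U, U, le_rfl, hU, h1, h2, h3⟩
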